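/- Strings are finite binary strings, and $|\sigma|$ is the length of $\sigma$. A prefix-free machine is a partial computable function $M(p,y)$ of a program $p$ and an input $y$ (both strings), with strings as outputs, such that for every $y$ the set of programs $p$ for which $M(p,y)$ is defined is prefix-free (no element is a proper prefix of another). A prefix-free machine $U$ is universal if for every prefix-free machine $M$ there is a constant $d$ such that whenever $M(p,y)=x$, there is a program $q$ with $|q|\le |p|+d$ and $U(q,y)=x$. Fix a universal prefix-free machine $U$, and let $$K(x\mid y)=\min\{|p| : U(p,y)=x\},\qquad K(x)=K(x\mid\lambda),\qquad K(x,y)=K(\langle x,y\rangle),$$ where $\lambda$ is the empty string and $\langle x,y\rangle=1^{|x|}0xy$ is the standard coding of pairs. Lemma (symmetry of information). For every constant $c$ there is a constant $C$ (depending only on $U$ and $c$) such that for all strings $\sigma$ and $\tau$: if $K(\sigma)>|\sigma|-c$, then $$|\sigma|+K(\tau\mid\sigma)\le K(\sigma,\tau)+C.$$ -/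

import Mathlib

namespace PrefixComplexity

/-- A prefix-free (self-delimiting) machine: a partial computable function which maps a program
`p` and an input `y` to an output string, such that for every input `y` no program on which the
machine halts is a proper prefix of another one. -/
structure IsPrefixFreeMachine (M : List Bool → List Bool →. List Bool) : Prop where
  partrec : Partrec₂ M
  prefixFree : ∀ y p q : List Bool, (M p y).Dom → (M q y).Dom → p <+: q → p = q

/-- A universal prefix-free machine: on every input it produces every output with at most
additive constant loss in the program length over any given prefix-free machine `M`. -/
structure IsUniversalPrefixFreeMachine (U : List Bool → List Bool →. List Bool) : Prop where
  isPrefixFreeMachine : IsPrefixFreeMachine U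
  universal : ∀ M : List Bool → List Bool →. List Bool, IsPrefixFreeMachine M →
    ∃ d : ℕ, ∀ p y x : List Bool, x ∈ M p y → ∃ q : List Bool, x ∈ U q y ∧ q.length ≤ p.length + d

/-- The conditional complexity `K(x | y)`: the minimal length of a program which outputs `x` on
input `y`. -/
noncomputable def condK (U : List Bool → List Bool →. List Bool) (x y : List Bool) : ℕ :=
  sInf {n : ℕ | ∃ p : List Bool, x ∈ U p y ∧ p.length = n}

/-- The complexity `K(x)`: the input is the empty string. -/
noncomputable def K (U : List Bool → List Bool →. List Bool) (x : List Bool) : ℕ :=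
  condK U x []

/-- The standard computable injective coding of pairs of strings, `(x, y) ↦ 1^|x| 0 x y`. -/
def pair (x y : List Bool) : List Bool :=
  List.replicate x.length true ++ false :: (x ++ y)

/-- The complexity `K(x, y)` of a pair of strings. -/
noncomputable def pairK (U : List Bool → List Bool →. List Bool) (x y : List Bool) : ℕ :=
  K U (pair x y)

/-! ### Soundness of the definitions -/

theorem idxOf_replicate (n : ℕ) (z : List Bool) :
    (List.replicate n true ++ false :: z).idxOf false = n := by
  induction n with
  | zero => simp
  | succ n ih => simp [List.replicate_succ, ih]

theorem pair_injective {x y x' y' : List Bool} (h : pair x y = pair x' y') :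
    x = x' ∧ y = y' := by
  have hl : x.length = x'.length := by
    have := congrArg (List.idxOf false) h
    simpa [pair, idxOf_replicate] using this
  unfold pair at h
  rw [hl] at h
  have h2 := List.append_cancel_left h
  simp only [List.cons.injEq, true_and] at h2
  exact List.append_inj h2 hl

/-- For a universal machine the minimum in `condK` is over a nonempty set. -/
theorem IsUniversalPrefixFreeMachine.exists_program {U : List Bool → List Bool →. List Bool}
    (hU : IsUniversalPrefixFreeMachine U) (x y : List Bool) : ∃ p, x ∈ U p y := by
  let M : List Bool → List Bool →. List Bool := fun p _ =>
    ((if p = [] then some x else none : Option (List Bool)) : Part (List Bool))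
  have hM : IsPrefixFreeMachine M := by
    refine ⟨?_, ?_⟩
    · refine Computable.ofOption (Primrec.to_comp ?_)
      exact Primrec.ite (Primrec.eq.comp Primrec.fst (Primrec.const []))
        (Primrec.const _) (Primrec.const _)
    · have key : ∀ y p, (M p y).Dom → p = [] := by
        intro y p h
        by_contra hp
        simp [M, hp] at h
      intro y p q hp hq _
      rw [key y p hp, key y q hq]
  obtain ⟨d, hd⟩ := hU.universal M hM
  obtain ⟨q, hq, -⟩ := hd [] y x (by simp [M])
  exact ⟨q, hq⟩

/-- A triple (number of steps, program, output), decoded from a number. -/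
def trial (k : ℕ) : ℕ × List Bool × List Bool :=
  (Encodable.decode (α := ℕ × List Bool × List Bool) k).getD (0, [], [])

/-- In the trial `k`, the code with number `e` halts on input `y` and a program that is comparable
with `q`. -/
abbrev Accepts (e : ℕ) (q y : List Bool) (k : ℕ) : Prop :=
  Nat.Partrec.Code.evaln (trial k).1 (Denumerable.ofNat Nat.Partrec.Code e)
      (Encodable.encode ((trial k).2.1, y)) = some (Encodable.encode (trial k).2.2) ∧
    (trial k).2.1.take q.length = q.take (trial k).2.1.length

/-- An explicit universal machine: on the program `1^e 0 q` it searches for the first trial in which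
the code `e` halts on a program comparable with `q`, and halts if that program is `q`. -/
def univ (p y : List Bool) : Part (List Bool) :=
  (Nat.rfind fun k => Part.some
      (decide (Accepts (p.idxOf false) (p.drop (p.idxOf false + 1)) y k))).bind fun k =>
    ((if (trial k).2.1 = p.drop (p.idxOf false + 1) ∧ p.idxOf false < p.length
      then some (trial k).2.2 else none : Option (List Bool)) : Part (List Bool))

theorem trial_encode (t : ℕ × List Bool × List Bool) : trial (Encodable.encode t) = t := by
  simp [trial]

theorem primrec_trial : Primrec trial :=
  Primrec.option_getD.comp Primrec.decode (Primrec.const _)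

theorem take_comparable {p q : List Bool} :
    p.take q.length = q.take p.length ↔ p <+: q ∨ q <+: p := by
  constructor
  · intro h
    rcases le_total p.length q.length with hl | hl
    · rw [List.take_of_length_le hl] at h
      exact Or.inl (h ▸ List.take_prefix _ _)
    · rw [List.take_of_length_le hl] at h
      exact Or.inr (h ▸ List.take_prefix _ _)
  · rintro (h | h)
    · rw [List.take_of_length_le h.length_le]
      exact List.prefix_iff_eq_take.1 h
    · rw [List.take_of_length_le (l := q) h.length_le]
      exact (List.prefix_iff_eq_take.1 h).symm

theorem partrec_univ : Partrec₂ univ := by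
  have hidx : Primrec fun p : List Bool => p.idxOf false :=
    Primrec.list_idxOf.comp (Primrec.const false) Primrec.id
  have hdrop : Primrec fun p : List Bool => p.drop (p.idxOf false + 1) :=
    Primrec.list_drop.comp (Primrec.succ.comp hidx) Primrec.id
  have hp : Primrec fun a : (List Bool × List Bool) × ℕ => a.1.1 := Primrec.fst.comp Primrec.fst
  have hw : Primrec fun a : (List Bool × List Bool) × ℕ => (trial a.2).2.1 :=
    Primrec.fst.comp (Primrec.snd.comp (primrec_trial.comp Primrec.snd))
  have hx : Primrec fun a : (List Bool × List Bool) × ℕ => (trial a.2).2.2 :=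
    Primrec.snd.comp (Primrec.snd.comp (primrec_trial.comp Primrec.snd))
  have hn : Primrec fun a : (List Bool × List Bool) × ℕ => (trial a.2).1 :=
    Primrec.fst.comp (primrec_trial.comp Primrec.snd)
  have hy : Primrec fun a : (List Bool × List Bool) × ℕ => a.1.2 := Primrec.snd.comp Primrec.fst
  refine Partrec.bind (Partrec.rfind (Computable.partrec (Primrec.to_comp ?_)))
    (Computable.ofOption (Primrec.to_comp ?_))
  · refine PrimrecPred.decide (PrimrecPred.and ?_ ?_)
    · refine Primrec.eq.comp ?_ (Primrec.option_some.comp (Primrec.encode.comp hx))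
      exact Nat.Partrec.Code.primrec_evaln.comp (Primrec.pair (Primrec.pair hn
        ((Primrec.ofNat _).comp (hidx.comp hp))) (Primrec.encode.comp (Primrec.pair hw hy)))
    · exact Primrec.eq.comp
        (Primrec.list_take.comp (Primrec.list_length.comp (hdrop.comp hp)) hw)
        (Primrec.list_take.comp (Primrec.list_length.comp hw) (hdrop.comp hp))
  · refine Primrec.ite (PrimrecPred.and ?_ ?_) (Primrec.option_some.comp hx) (Primrec.const _)
    · exact Primrec.eq.comp hw (hdrop.comp hp)
    · exact Primrec.nat_lt.comp (hidx.comp hp) (Primrec.list_length.comp hp)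

theorem mem_univ {p y x : List Bool} : x ∈ univ p y ↔
    ∃ k, Accepts (p.idxOf false) (p.drop (p.idxOf false + 1)) y k ∧
      (∀ m < k, ¬ Accepts (p.idxOf false) (p.drop (p.idxOf false + 1)) y m) ∧
      p.idxOf false < p.length ∧ trial k = ((trial k).1, p.drop (p.idxOf false + 1), x) := by
  unfold univ
  rw [Part.mem_bind_iff]
  refine exists_congr fun k => ?_
  refine (and_congr Nat.mem_rfind Part.mem_ofOption).trans ?_
  constructor
  · rintro ⟨⟨h1, h2⟩, h3⟩
    split_ifs at h3 with hc
    · refine ⟨of_decide_eq_true (Part.mem_some_iff.1 h1).symm,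
        fun m hm => of_decide_eq_false (Part.mem_some_iff.1 (h2 hm)).symm, hc.2, ?_⟩
      have : (trial k).2.2 = x := by simpa using h3
      rw [← this, ← hc.1]
    · simp at h3
  · rintro ⟨h1, h2, h3, h4⟩
    refine ⟨⟨Part.mem_some_iff.2 (decide_eq_true h1).symm,
      fun {m} hm => Part.mem_some_iff.2 (decide_eq_false (h2 m hm)).symm⟩, ?_⟩
    have h5 := congrArg (fun t => t.2.1) h4
    have h6 := congrArg (fun t => t.2.2) h4
    simp only at h5 h6
    simp [h5, h6, h3]

theorem eq_prefix_of_idxOf : ∀ p : List Bool, p.idxOf false < p.length →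
    p = List.replicate (p.idxOf false) true ++ false :: p.drop (p.idxOf false + 1)
  | [], h => by simp at h
  | false :: p, _ => by simp
  | true :: p, h => by
    have h' : p.idxOf false < p.length := by
      simpa [List.idxOf_cons] using h
    have := eq_prefix_of_idxOf p h'
    have hi : (true :: p).idxOf false = p.idxOf false + 1 := by simp
    rw [hi, List.replicate_succ, List.cons_append, List.drop_succ_cons, ← this]

/-- Universal prefix-free machines exist. -/
theorem isUniversalPrefixFreeMachine_univ : IsUniversalPrefixFreeMachine univ := by
  refine ⟨⟨partrec_univ, ?_⟩, ?_⟩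
  · intro y p p' hp hp' hpp
    obtain ⟨k, h1, h2, h3, h4⟩ := mem_univ.1 (Part.get_mem hp)
    obtain ⟨k', h1', h2', h3', h4'⟩ := mem_univ.1 (Part.get_mem hp')
    have he : p'.idxOf false = p.idxOf false := by
      obtain ⟨z, rfl⟩ := hpp
      exact List.idxOf_append_of_mem (List.idxOf_lt_length_iff.1 h3)
    have hq : p.drop (p.idxOf false + 1) <+: p'.drop (p'.idxOf false + 1) := by
      rw [he]; exact hpp.drop _
    have e1 := eq_prefix_of_idxOf p h3
    have e2 := eq_prefix_of_idxOf p' h3'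
    have w1 : (trial k).2.1 = p.drop (p.idxOf false + 1) := congrArg (fun t => t.2.1) h4
    have w2 : (trial k').2.1 = p'.drop (p'.idxOf false + 1) := congrArg (fun t => t.2.1) h4'
    rw [he] at h1' h2' w2 hq e2
    have a1 : Accepts (p.idxOf false) (p'.drop (p.idxOf false + 1)) y k :=
      ⟨h1.1, take_comparable.2 (Or.inl (w1 ▸ hq))⟩
    have a2 : Accepts (p.idxOf false) (p.drop (p.idxOf false + 1)) y k' :=
      ⟨h1'.1, take_comparable.2 (Or.inr (w2 ▸ hq))⟩
    have hk : k = k' := by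
      rcases lt_trichotomy k k' with h | h | h
      · exact absurd a1 (h2' k h)
      · exact h
      · exact absurd a2 (h2 k' h)
    subst hk
    rw [e1, e2, ← w1, ← w2]
  · intro M hM
    obtain ⟨c, hc⟩ := Nat.Partrec.Code.exists_code.1 hM.partrec
    have hmem : ∀ p y x : List Bool, Encodable.encode x ∈ c.eval (Encodable.encode (p, y)) ↔
        x ∈ M p y := by
      intro p y x
      rw [hc]
      simp
    have hsound : ∀ k y, Nat.Partrec.Code.evaln (trial k).1 c
        (Encodable.encode ((trial k).2.1, y)) = some (Encodable.encode (trial k).2.2) →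
        (trial k).2.2 ∈ M (trial k).2.1 y := by
      intro k y h
      exact (hmem _ _ _).1 (Nat.Partrec.Code.evaln_sound h)
    refine ⟨Encodable.encode c + 1, fun p y x hx => ?_⟩
    set e := Encodable.encode c with he
    refine ⟨List.replicate e true ++ false :: p, ?_, by simp; omega⟩
    have hidx := idxOf_replicate e p
    have hdrop : (List.replicate e true ++ false :: p).drop (e + 1) = p := by
      rw [List.drop_append]; simp
    rw [mem_univ, hidx, hdrop]
    have hof : Denumerable.ofNat Nat.Partrec.Code e = c := by simp [he]
    have hex : ∃ k, Accepts e p y k := by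
      obtain ⟨n, hn⟩ := Nat.Partrec.Code.evaln_complete.1 ((hmem p y x).2 hx)
      refine ⟨Encodable.encode (n, p, x), ?_, ?_⟩
      · rw [trial_encode, hof]; exact hn
      · rw [trial_encode]
    classical
    have hspec := Nat.find_spec hex
    refine ⟨Nat.find hex, hspec, fun m hm => Nat.find_min hex hm, by simp, ?_⟩
    have hM' := hsound (Nat.find hex) y (by rw [← hof]; exact hspec.1)
    have hw : (trial (Nat.find hex)).2.1 = p := by
      have hd : (M p y).Dom := Part.dom_iff_mem.2 ⟨_, hx⟩
      have hd' : (M (trial (Nat.find hex)).2.1 y).Dom := Part.dom_iff_mem.2 ⟨_, hM'⟩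
      rcases take_comparable.1 hspec.2 with h | h
      · exact hM.prefixFree y _ _ hd' hd h
      · exact (hM.prefixFree y _ _ hd hd' h).symm
    rw [hw] at hM'
    have hxx := Part.mem_unique hM' hx
    exact Prod.ext rfl (Prod.ext hw hxx)

end PrefixComplexity

namespace PrefixComplexity

/-! Let `P(σ)` be the total weight `∑ 2^(-|p|)` of the programs `p` for which `U(p, λ)` decodes to a
pair with first component `σ`; the sum of all `P(σ)` is at most 1. Given `σ`, let each such `p`
request a codeword of length `|p| + 2k - |σ|` for the second component. If these requests have
weight below 1, the Kraft–Chaitin theorem (`condK_le_of_request`) gives `K(τ | σ) ≤ K(σ, τ) + 2k -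
|σ| + O(1)`, which is the claim. If the weight reaches 1, then `P(σ) ≥ 2^(2k - |σ|)`. Requesting
length `|σ| - 2k` for every such `σ` costs at most `∑ P(σ) ≤ 1` (`kraftSum_overflowRequest_le`), and
`k` suffices to enumerate these requests. Hence `K(σ | 1^k) ≤ |σ| - 2k + O(1)`. Paying `k` bits to
remove the condition (`K_le_condK_replicate`) leaves `K(σ) ≤ |σ| - k + O(1)`, with a constant
independent of `k`. For large `k` this contradicts `K(σ) > |σ| - c`. -/

/-! ### Strings as binary numerals. -/

/-- The number with the binary expansion `q`, most significant digit first. -/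
def binVal (q : List Bool) : ℕ :=
  q.foldl (fun a b => 2 * a + cond b 1 0) 0

theorem foldl_eq_binVal (q : List Bool) (a : ℕ) :
    q.foldl (fun a b => 2 * a + cond b 1 0) a = a * 2 ^ q.length + binVal q := by
  unfold binVal
  induction q generalizing a with
  | nil => simp
  | cons b q ih =>
    rw [List.foldl_cons, List.foldl_cons, ih, ih (2 * 0 + _), List.length_cons]
    ring

theorem binVal_append (p q : List Bool) :
    binVal (p ++ q) = binVal p * 2 ^ q.length + binVal q := by
  rw [binVal, List.foldl_append, foldl_eq_binVal, ← binVal]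

theorem binVal_singleton (b : Bool) : binVal [b] = cond b 1 0 := by
  simp [binVal]

theorem exists_binVal_eq {l v : ℕ} (h : v < 2 ^ l) :
    ∃ q : List Bool, q.length = l ∧ binVal q = v := by
  induction l generalizing v with
  | zero => exact ⟨[], rfl, by simp at h; simp [binVal, h]⟩
  | succ l ih =>
    obtain ⟨q, hq, hv⟩ := ih (v := v / 2) (by rw [pow_succ] at h; omega)
    refine ⟨q ++ [decide (v % 2 = 1)], by simp [hq], ?_⟩
    rw [binVal_append, hv, binVal_singleton]
    rcases Nat.mod_two_eq_zero_or_one v with h2 | h2 <;> simp [h2] <;> omega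

theorem binVal_lt (q : List Bool) : binVal q < 2 ^ q.length := by
  induction q with
  | nil => simp [binVal]
  | cons b q ih =>
    have h := binVal_append [b] q
    rw [List.singleton_append, binVal_singleton] at h
    rw [h, List.length_cons, pow_succ]
    cases b <;> simp <;> omega

theorem primrec_binVal : Primrec binVal := by
  refine Primrec.list_foldl (h := fun _ s => 2 * s.1 + cond s.2 1 0) Primrec.id
    (Primrec.const 0) ?_
  have hb : Primrec fun b : Bool => cond b 1 0 := Primrec.dom_bool _
  exact Primrec.to₂ (Primrec.nat_add.comp
    (Primrec.nat_mul.comp (Primrec.const 2) (Primrec.fst.comp Primrec.snd))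
    (hb.comp (Primrec.snd.comp Primrec.snd)))

theorem primrec_two_pow : Primrec fun n : ℕ => 2 ^ n :=
  (Primrec₂.unpaired'.1 Nat.Primrec.pow).comp (Primrec.const 2) Primrec.id

/-! ### Kraft–Chaitin coding of a stream of requests. -/

/-- The total weight `∑ 2 ^ (-ℓ i)` of the first `n` requests for codewords of length `ℓ i`. -/
noncomputable def kraftSum (ℓ : ℕ → Option ℕ) (n : ℕ) : ℝ :=
  ∑ i ∈ Finset.range n, (ℓ i).elim 0 fun l => (1 / 2 : ℝ) ^ l

/-- A numerator and a denominator of `kraftSum ℓ n`. -/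
def kraftState (ℓ : ℕ → Option ℕ) : ℕ → ℕ × ℕ
  | 0 => (0, 1)
  | n + 1 => ((ℓ n).map fun l =>
      ((kraftState ℓ n).1 * 2 ^ l + (kraftState ℓ n).2, (kraftState ℓ n).2 * 2 ^ l)).getD
        (kraftState ℓ n)

theorem kraftSum_succ {ℓ : ℕ → Option ℕ} {n l : ℕ} (h : ℓ n = some l) :
    kraftSum ℓ (n + 1) = kraftSum ℓ n + (1 / 2) ^ l := by
  simp [kraftSum, Finset.sum_range_succ, h]

theorem kraftSum_mono (ℓ : ℕ → Option ℕ) : Monotone (kraftSum ℓ) := by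
  refine monotone_nat_of_le_succ fun n => ?_
  rw [kraftSum, kraftSum, Finset.sum_range_succ]
  have : 0 ≤ (ℓ n).elim 0 fun l => (1 / 2 : ℝ) ^ l := by
    cases ℓ n <;> simp
  linarith

theorem kraftState_snd_pos (ℓ : ℕ → Option ℕ) (n : ℕ) : 0 < (kraftState ℓ n).2 := by
  induction n with
  | zero => simp [kraftState]
  | succ n ih =>
    rw [kraftState]
    cases ℓ n with
    | none => exact ih
    | some l => exact Nat.mul_pos ih (by positivity)

theorem kraftState_fst (ℓ : ℕ → Option ℕ) (n : ℕ) :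
    ((kraftState ℓ n).1 : ℝ) = kraftSum ℓ n * (kraftState ℓ n).2 := by
  induction n with
  | zero => simp [kraftState, kraftSum]
  | succ n ih =>
    rw [kraftState]
    cases h : ℓ n with
    | none => simpa [kraftSum, Finset.sum_range_succ, h] using ih
    | some l =>
      simp only [Option.map_some, Option.getD_some, Nat.cast_add, Nat.cast_mul, Nat.cast_pow,
        Nat.cast_ofNat, kraftSum_succ h, ih]
      rw [one_div, inv_pow]
      field_simp

/-- Makes a comparison of real sums decidable by a primitive recursive test, as `overflowRequest`
requires. -/
theorem kraftSum_lt_one_iff (ℓ : ℕ → Option ℕ) (n : ℕ) :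
    kraftSum ℓ n < 1 ↔ (kraftState ℓ n).1 < (kraftState ℓ n).2 := by
  have h : (0 : ℝ) < (kraftState ℓ n).2 := by exact_mod_cast kraftState_snd_pos ℓ n
  rw [← Nat.cast_lt (α := ℝ), kraftState_fst]
  exact ⟨fun h1 => by nlinarith, fun h1 => by by_contra! h2; nlinarith⟩

theorem primrec_kraftState {α : Type*} [Primcodable α] {ℓ : α → ℕ → Option ℕ} (h : Primrec₂ ℓ) :
    Primrec₂ fun a n => kraftState (ℓ a) n := by
  have hs : Primrec₂ fun (a : α) (s : ℕ × ℕ × ℕ) => ((ℓ a s.1).map fun l =>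
      (s.2.1 * 2 ^ l + s.2.2, s.2.2 * 2 ^ l)).getD s.2 := by
    have h1 : Primrec fun b : (α × ℕ × ℕ × ℕ) × ℕ => b.1.2.2.1 :=
      Primrec.fst.comp (Primrec.snd.comp (Primrec.snd.comp Primrec.fst))
    have h2 : Primrec fun b : (α × ℕ × ℕ × ℕ) × ℕ => b.1.2.2.2 :=
      Primrec.snd.comp (Primrec.snd.comp (Primrec.snd.comp Primrec.fst))
    have hp : Primrec fun b : (α × ℕ × ℕ × ℕ) × ℕ => 2 ^ b.2 := primrec_two_pow.comp Primrec.snd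
    refine Primrec.option_getD.comp (Primrec.option_map
      (h.comp Primrec.fst (Primrec.fst.comp Primrec.snd)) ?_) (Primrec.snd.comp Primrec.snd)
    exact Primrec.pair (Primrec.nat_add.comp (Primrec.nat_mul.comp h1 hp) h2)
      (Primrec.nat_mul.comp h2 hp)
  refine (Primrec.nat_rec (Primrec.const ((0, 1) : ℕ × ℕ)) hs).of_eq fun a n => ?_
  induction n with
  | zero => rfl
  | succ n ih =>
    simp only [kraftState, ← ih]

/-- `q` is the codeword of length `l + 1` assigned to the request number `n`: the dyadic interval of
`q` lies between `kraftSum ℓ n` and `kraftSum ℓ n + 2 ^ (-l)`. -/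
def IsCodeword (ℓ : ℕ → Option ℕ) (n l : ℕ) (q : List Bool) : Prop :=
  q.length = l + 1 ∧
    binVal q = (kraftState ℓ n).1 * 2 ^ (l + 1) / (kraftState ℓ n).2 + 1

instance (ℓ : ℕ → Option ℕ) (n l : ℕ) (q : List Bool) : Decidable (IsCodeword ℓ n l q) :=
  inferInstanceAs (Decidable (_ ∧ _))

theorem kraftState_div_bounds (ℓ : ℕ → Option ℕ) (n m : ℕ) :
    (((kraftState ℓ n).1 * 2 ^ m / (kraftState ℓ n).2 : ℕ) : ℝ) ≤ kraftSum ℓ n * 2 ^ m ∧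
      kraftSum ℓ n * 2 ^ m < ((kraftState ℓ n).1 * 2 ^ m / (kraftState ℓ n).2 : ℕ) + 1 := by
  have hP := kraftState_snd_pos ℓ n
  have hP' : (0 : ℝ) < (kraftState ℓ n).2 := by exact_mod_cast hP
  have hS : kraftSum ℓ n * 2 ^ m =
      (((kraftState ℓ n).1 * 2 ^ m : ℕ) : ℝ) / (kraftState ℓ n).2 := by
    push_cast
    rw [kraftState_fst]
    field_simp
  rw [hS, le_div_iff₀ hP', div_lt_iff₀ hP']
  constructor
  · exact_mod_cast Nat.div_mul_le_self _ _
  · rw [mul_comm _ ((kraftState ℓ n).2 : ℝ)]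
    exact_mod_cast Nat.lt_mul_div_succ _ hP

/-- In units of `2^(-(l+1))` the slot of the request has length 2, so it contains the unit cell
starting at the first integer beyond its left end. The extra bit in the codeword length buys this
rounding. -/
theorem IsCodeword.bounds {ℓ : ℕ → Option ℕ} {n l : ℕ} {q : List Bool} (hn : ℓ n = some l)
    (h : IsCodeword ℓ n l q) : kraftSum ℓ n * 2 ^ q.length < binVal q ∧
      (binVal q : ℝ) + 1 ≤ kraftSum ℓ (n + 1) * 2 ^ q.length := by
  obtain ⟨hl, hv⟩ := h
  have hb := kraftState_div_bounds ℓ n (l + 1)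
  have h2 : (1 / 2 : ℝ) ^ l * 2 ^ (l + 1) = 2 := by
    rw [pow_succ, ← mul_assoc, ← mul_pow]; norm_num
  rw [hl, hv, kraftSum_succ hn, add_mul, h2]
  push_cast
  constructor <;> linarith

/-- Codewords of different requests are not prefixes of each other. -/
theorem IsCodeword.unique {ℓ : ℕ → Option ℕ} {n m l k : ℕ} {p q : List Bool}
    (hn : ℓ n = some l) (hm : ℓ m = some k) (hp : IsCodeword ℓ n l p) (hq : IsCodeword ℓ m k q)
    (hpq : p <+: q) : n = m := by
  obtain ⟨r, rfl⟩ := hpq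
  obtain ⟨a1, a2⟩ := hp.bounds hn
  obtain ⟨b1, b2⟩ := hq.bounds hm
  have hr : ((binVal r : ℕ) : ℝ) + 1 ≤ 2 ^ r.length := by exact_mod_cast binVal_lt r
  have h0 : (0 : ℝ) ≤ binVal r := by positivity
  rw [List.length_append, binVal_append, pow_add] at b1 b2
  push_cast at b1 b2
  have hP : (0 : ℝ) < 2 ^ p.length := by positivity
  have hR : (0 : ℝ) < 2 ^ r.length := by positivity
  -- The cell of an extension of `p` lies inside the cell of `p`, while slots of distinct requests
  -- do not overlap.
  rcases lt_trichotomy n m with h | h | h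
  · have hs : kraftSum ℓ (n + 1) ≤ kraftSum ℓ m := kraftSum_mono ℓ h
    have h1 := mul_le_mul_of_nonneg_right a2 hR.le
    have h2 := mul_le_mul_of_nonneg_right hs (mul_pos hP hR).le
    nlinarith
  · exact h
  · have hs : kraftSum ℓ (m + 1) ≤ kraftSum ℓ n := kraftSum_mono ℓ h
    have h1 := mul_lt_mul_of_pos_right a1 hR
    have h2 := mul_le_mul_of_nonneg_right hs (mul_pos hP hR).le
    nlinarith

theorem exists_isCodeword {ℓ : ℕ → Option ℕ} {n l : ℕ} (hn : ℓ n = some l)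
    (h : kraftSum ℓ (n + 1) ≤ 1) : ∃ q, IsCodeword ℓ n l q := by
  refine exists_binVal_eq ?_
  have hb := (kraftState_div_bounds ℓ n (l + 1)).1
  have h2 : (1 / 2 : ℝ) ^ l * 2 ^ (l + 1) = 2 := by
    rw [pow_succ, ← mul_assoc, ← mul_pow]; norm_num
  have h3 := mul_le_mul_of_nonneg_right h (by positivity : (0 : ℝ) ≤ 2 ^ (l + 1))
  rw [kraftSum_succ hn, add_mul, h2, one_mul] at h3
  rw [← Nat.cast_lt (α := ℝ)]
  push_cast
  linarith

/-- The machine which serves the requests `r y`: on input `y`, the codeword of the `n`-th request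
`(l, x)` is a program for `x`. -/
def kraftMachine (r : List Bool → ℕ → Option (ℕ × List Bool)) (q y : List Bool) :
    Part (List Bool) :=
  Nat.rfindOpt fun n => (r y n).bind fun a =>
    if IsCodeword (fun i => (r y i).map Prod.fst) n a.1 q then some a.2 else none

theorem exists_of_mem_kraftMachine {r : List Bool → ℕ → Option (ℕ × List Bool)}
    {q y x : List Bool} (h : x ∈ kraftMachine r q y) :
    ∃ n l, r y n = some (l, x) ∧ IsCodeword (fun i => (r y i).map Prod.fst) n l q := by
  obtain ⟨n, hn⟩ := Nat.rfindOpt_spec h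
  rw [Option.mem_def, Option.bind_eq_some_iff] at hn
  obtain ⟨⟨l, z⟩, hr, ha⟩ := hn
  split_ifs at ha with hc
  simp only [Option.some.injEq] at ha
  exact ⟨n, l, ha ▸ hr, hc⟩

/-- No bound on the total weight is needed: a request whose cell would lie beyond 1 has no codeword,
and the cells in use stay disjoint. -/
theorem isPrefixFreeMachine_kraftMachine {r : List Bool → ℕ → Option (ℕ × List Bool)}
    (hr : Primrec₂ r) : IsPrefixFreeMachine (kraftMachine r) := by
  constructor
  · refine Partrec.rfindOpt (Primrec.to_comp ?_)
    have hy : Primrec fun b : ((List Bool × List Bool) × ℕ) × ℕ × List Bool => b.1.1.2 :=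
      Primrec.snd.comp (Primrec.fst.comp Primrec.fst)
    have hq : Primrec fun b : ((List Bool × List Bool) × ℕ) × ℕ × List Bool => b.1.1.1 :=
      Primrec.fst.comp (Primrec.fst.comp Primrec.fst)
    have hl : Primrec fun b : ((List Bool × List Bool) × ℕ) × ℕ × List Bool => b.2.1 + 1 :=
      Primrec.succ.comp (Primrec.fst.comp Primrec.snd)
    have hs : Primrec fun b : ((List Bool × List Bool) × ℕ) × ℕ × List Bool =>
        kraftState (fun i => (r b.1.1.2 i).map Prod.fst) b.1.2 :=
      (primrec_kraftState (ℓ := fun y i => (r y i).map Prod.fst)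
        (Primrec.option_map hr (Primrec.fst.comp Primrec.snd))).comp hy
          (Primrec.snd.comp Primrec.fst)
    refine Primrec.option_bind (hr.comp (Primrec.snd.comp Primrec.fst) Primrec.snd) ?_
    refine Primrec.ite (PrimrecPred.and ?_ ?_)
      (Primrec.option_some.comp (Primrec.snd.comp Primrec.snd)) (Primrec.const none)
    · exact Primrec.eq.comp (Primrec.list_length.comp hq) hl
    · exact Primrec.eq.comp (primrec_binVal.comp hq) (Primrec.succ.comp (Primrec.nat_div.comp
        (Primrec.nat_mul.comp (Primrec.fst.comp hs) (primrec_two_pow.comp hl))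
        (Primrec.snd.comp hs)))
  · intro y p q hp hq hpq
    obtain ⟨n, l, hn, hc⟩ := exists_of_mem_kraftMachine (Part.get_mem hp)
    obtain ⟨m, k, hm, hc'⟩ := exists_of_mem_kraftMachine (Part.get_mem hq)
    obtain rfl := IsCodeword.unique (by simp [hn]) (by simp [hm]) hc hc' hpq
    rw [hn] at hm
    simp only [Option.some.injEq, Prod.mk.injEq] at hm
    exact hpq.eq_of_length (by rw [hc.1, hc'.1, hm.1])

theorem exists_mem_kraftMachine {r : List Bool → ℕ → Option (ℕ × List Bool)}
    {y x : List Bool} {n l : ℕ} (hn : r y n = some (l, x))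
    (h : kraftSum (fun i => (r y i).map Prod.fst) (n + 1) ≤ 1) :
    ∃ q : List Bool, x ∈ kraftMachine r q y ∧ q.length = l + 1 := by
  obtain ⟨q, hq⟩ := exists_isCodeword (l := l) (by simp [hn]) h
  refine ⟨q, ?_, hq.1⟩
  have hd : (kraftMachine r q y).Dom :=
    Nat.rfindOpt_dom.2 ⟨n, x, by simpa [hn] using hq⟩
  -- The search may stop at another index `m`, but `q` is the codeword of only one request.
  obtain ⟨m, k, hm, hc⟩ := exists_of_mem_kraftMachine (Part.get_mem hd)
  obtain rfl := IsCodeword.unique (by simp [hn]) (by simp [hm]) hq hc List.prefix_rfl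
  rw [hn] at hm
  simp only [Option.some.injEq, Prod.mk.injEq] at hm
  rw [hm.2]
  exact Part.get_mem hd

theorem condK_le {U : List Bool → List Bool →. List Bool} {p x y : List Bool} (h : x ∈ U p y) :
    condK U x y ≤ p.length :=
  Nat.sInf_le ⟨p, h, rfl⟩

theorem IsUniversalPrefixFreeMachine.exists_length_eq {U : List Bool → List Bool →. List Bool}
    (hU : IsUniversalPrefixFreeMachine U) (x y : List Bool) :
    ∃ p, x ∈ U p y ∧ p.length = condK U x y := by
  obtain ⟨p, hp⟩ := hU.exists_program x y
  exact Nat.sInf_mem (s := {n : ℕ | ∃ p : List Bool, x ∈ U p y ∧ p.length = n}) ⟨_, p, hp, rfl⟩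

/-- The Kraft–Chaitin theorem, uniformly in the condition `y`. -/
theorem IsUniversalPrefixFreeMachine.condK_le_of_request {U : List Bool → List Bool →. List Bool}
    (hU : IsUniversalPrefixFreeMachine U) {r : List Bool → ℕ → Option (ℕ × List Bool)}
    (hr : Primrec₂ r) : ∃ d : ℕ, ∀ y x n l, r y n = some (l, x) →
      kraftSum (fun i => (r y i).map Prod.fst) (n + 1) ≤ 1 → condK U x y ≤ l + d := by
  obtain ⟨d, hd⟩ := hU.universal _ (isPrefixFreeMachine_kraftMachine hr)
  refine ⟨d + 1, fun y x n l hn h => ?_⟩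
  obtain ⟨p, hp, hl⟩ := exists_mem_kraftMachine hn h
  obtain ⟨q, hq, hle⟩ := hd p y x hp
  have := condK_le hq
  omega

/-! ### Enumeration of programs and Kraft's inequality. -/

open Encodable in
/-- The graph of a partial computable function has a primitive recursive enumeration which lists
every argument at most once. -/
theorem exists_enumeration {M : List Bool →. List Bool} (hM : Partrec M) :
    ∃ e : ℕ → Option (List Bool × List Bool), Primrec e ∧
      (∀ n p z, e n = some (p, z) → z ∈ M p) ∧ (∀ p z, z ∈ M p → ∃ n, e n = some (p, z)) ∧
      ∀ n m p z z', e n = some (p, z) → e m = some (p, z') → n = m := by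
  obtain ⟨c, hc⟩ := Nat.Partrec.Code.exists_code.1 hM
  have hmem : ∀ p z : List Bool, encode z ∈ c.eval (encode p) ↔ z ∈ M p := by
    intro p z
    rw [hc]
    simp
  let ev : ℕ → List Bool → Option ℕ := fun k p => Nat.Partrec.Code.evaln k c (encode p)
  have hev : Primrec₂ ev := Nat.Partrec.Code.primrec_evaln.comp (Primrec.pair
    (Primrec.pair Primrec.fst (Primrec.const c)) (Primrec.encode.comp Primrec.snd))
  -- Only the first stage at which `p` halts is accepted. The test `encode (trial n) = n` discards
  -- the default value of `trial` and duplicate codes.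
  let e : ℕ → Option (List Bool × List Bool) := fun n =>
    if (ev (trial n).1 (trial n).2.1 = some (encode (trial n).2.2) ∧
      ev ((trial n).1 - 1) (trial n).2.1 = none) ∧ encode (trial n) = n
    then some (trial n).2 else none
  have he : ∀ n p z, e n = some (p, z) ↔ ∃ k, n = encode (k, p, z) ∧ ev k p = some (encode z) ∧
      ev (k - 1) p = none := by
    intro n p z
    constructor
    · intro h
      simp only [e] at h
      split_ifs at h with hc
      obtain ⟨⟨h1, h2⟩, h3⟩ := hc
      simp only [Option.some.injEq] at h
      refine ⟨(trial n).1, ?_, ?_, ?_⟩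
      · rw [← h, Prod.mk.eta, h3]
      · rwa [h] at h1
      · rwa [h] at h2
    · rintro ⟨k, rfl, h1, h2⟩
      simp only [e, trial_encode, h1, h2, and_self, if_true]
  have hsound : ∀ k p z, ev k p = some (encode z) → z ∈ M p := fun k p z h =>
    (hmem p z).1 (Nat.Partrec.Code.evaln_sound h)
  refine ⟨e, ?_, ?_, ?_, ?_⟩
  · have hk : Primrec fun n => (trial n).1 := Primrec.fst.comp primrec_trial
    have hp : Primrec fun n => (trial n).2.1 := Primrec.fst.comp (Primrec.snd.comp primrec_trial)
    have hz : Primrec fun n => (trial n).2.2 := Primrec.snd.comp (Primrec.snd.comp primrec_trial)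
    refine Primrec.ite (PrimrecPred.and (PrimrecPred.and ?_ ?_) ?_)
      (Primrec.option_some.comp (Primrec.snd.comp primrec_trial)) (Primrec.const none)
    · exact Primrec.eq.comp (hev.comp hk hp) (Primrec.option_some.comp (Primrec.encode.comp hz))
    · exact Primrec.eq.comp (hev.comp (Primrec.nat_sub.comp hk (Primrec.const 1)) hp)
        (Primrec.const none)
    · exact Primrec.eq.comp (Primrec.encode.comp primrec_trial) Primrec.id
  · intro n p z h
    obtain ⟨k, -, h1, -⟩ := (he n p z).1 h
    exact hsound k p z h1
  · intro p z h
    classical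
    have hex : ∃ k, ev k p = some (encode z) :=
      Nat.Partrec.Code.evaln_complete.1 ((hmem p z).2 h)
    refine ⟨_, (he _ p z).2 ⟨Nat.find hex, rfl, Nat.find_spec hex, ?_⟩⟩
    -- At stage 0 the truncated predecessor is 0 itself, where `evaln` never halts.
    rcases Nat.eq_zero_or_pos (Nat.find hex) with h0 | h0
    · rw [h0]
      simp [ev, Nat.Partrec.Code.evaln]
    · by_contra hne
      obtain ⟨w, hw⟩ := Option.ne_none_iff_exists'.1 hne
      have hw' := Nat.Partrec.Code.evaln_mono (Nat.sub_le _ 1) (Option.mem_def.2 hw)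
      have hf : ev (Nat.find hex) p = some w := hw'
      rw [Nat.find_spec hex] at hf
      exact Nat.find_min hex (Nat.sub_lt h0 one_pos) (hw.trans hf.symm)
  · intro n m p z z' hn hm
    obtain ⟨k, rfl, h1, h2⟩ := (he n p z).1 hn
    obtain ⟨k', rfl, h1', h2'⟩ := (he m p z').1 hm
    obtain rfl := Part.mem_unique (hsound _ _ _ h1) (hsound _ _ _ h1')
    have hle : ∀ i j, ev i p = some (encode z) → ev (j - 1) p = none → j ≤ i := by
      intro i j hi hj
      by_contra! hlt
      have := Nat.Partrec.Code.evaln_mono (show i ≤ j - 1 by omega) (Option.mem_def.2 hi)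
      have h3 : ev (j - 1) p = some (encode z) := this
      rw [hj] at h3
      cases h3
    rw [le_antisymm (hle k' k h1' h2) (hle k k' h1 h2')]

/-- The first words of two factorizations are prefixes of one string, hence comparable, hence equal.
The empty word is excluded because it could be inserted freely. -/
theorem uniquelyDecodable_of_prefixFree {α : Type*} {S : Set (List α)} (h0 : [] ∉ S)
    (h : ∀ p ∈ S, ∀ q ∈ S, p <+: q → p = q) : InformationTheory.UniquelyDecodable S := by
  intro L₁
  induction L₁ with
  | nil =>
    intro L₂ _ h2 he
    cases L₂ with
    | nil => rfl
    | cons w L =>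
      simp only [List.flatten_nil, List.flatten_cons] at he
      have hw : w = [] := (List.append_eq_nil_iff.1 he.symm).1
      exact absurd (hw ▸ h2 w (by simp)) h0
  | cons v L₁ ih =>
    intro L₂ h1 h2 he
    cases L₂ with
    | nil =>
      simp only [List.flatten_nil, List.flatten_cons] at he
      have hv : v = [] := (List.append_eq_nil_iff.1 he).1
      exact absurd (hv ▸ h1 v (by simp)) h0
    | cons w L₂ =>
      simp only [List.flatten_cons] at he
      have hvw : v = w := by
        rcases List.prefix_or_prefix_of_prefix (List.prefix_append v L₁.flatten)
          (he ▸ List.prefix_append w L₂.flatten) with hp | hp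
        · exact h _ (h1 v (by simp)) _ (h2 w (by simp)) hp
        · exact (h _ (h2 w (by simp)) _ (h1 v (by simp)) hp).symm
      subst hvw
      rw [ih L₂ (fun u hu => h1 u (by simp [hu])) (fun u hu => h2 u (by simp [hu]))
        (List.append_cancel_left he)]

/-- Kraft's inequality for prefix-free codes. -/
theorem sum_le_one_of_prefixFree (S : Finset (List Bool))
    (h : ∀ p ∈ S, ∀ q ∈ S, p <+: q → p = q) : ∑ p ∈ S, (1 / 2 : ℝ) ^ p.length ≤ 1 := by
  by_cases h0 : [] ∈ S
  · have : S = {[]} := by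
      ext q
      rw [Finset.mem_singleton]
      exact ⟨fun hq => (h _ h0 _ hq (List.nil_prefix)).symm, fun hq => hq ▸ h0⟩
    simp [this]
  · simpa using InformationTheory.kraft_mcmillan_inequality
      (uniquelyDecodable_of_prefixFree (S := (S : Set (List Bool))) (by simpa using h0)
        (by simpa using h))

/-- By `hinj` the sum over indices is a sum over distinct halting programs, a prefix-free set. -/
theorem IsPrefixFreeMachine.kraftSum_le_one {M : List Bool → List Bool →. List Bool}
    (hM : IsPrefixFreeMachine M) {y : List Bool} {e : ℕ → Option (List Bool × List Bool)}
    (he : ∀ n p z, e n = some (p, z) → z ∈ M p y)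
    (hinj : ∀ n m p z z', e n = some (p, z) → e m = some (p, z') → n = m) (N : ℕ) :
    kraftSum (fun n => (e n).map fun a => a.1.length) N ≤ 1 := by
  classical
  let s := (Finset.range N).filter fun n => (e n).isSome
  let f : ℕ → List Bool := fun n => ((e n).getD ([], [])).1
  have hf : ∀ n ∈ s, ∃ z, e n = some (f n, z) := by
    intro n hn
    obtain ⟨a, ha⟩ := Option.isSome_iff_exists.1 (Finset.mem_filter.1 hn).2
    exact ⟨a.2, by simp [f, ha]⟩
  have hsum : kraftSum (fun n => (e n).map fun a => a.1.length) N =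
      ∑ p ∈ s.image f, (1 / 2 : ℝ) ^ p.length := by
    rw [Finset.sum_image, kraftSum, Finset.sum_filter]
    · refine Finset.sum_congr rfl fun n _ => ?_
      cases h : e n <;> simp [f, h]
    · intro n hn m hm hnm
      obtain ⟨z, hz⟩ := hf n hn
      obtain ⟨z', hz'⟩ := hf m hm
      rw [← hnm] at hz'
      exact hinj n m _ _ _ hz hz'
  rw [hsum]
  refine sum_le_one_of_prefixFree _ ?_
  have hdom : ∀ p ∈ s.image f, (M p y).Dom := by
    intro p hp
    obtain ⟨n, hn, rfl⟩ := Finset.mem_image.1 hp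
    obtain ⟨z, hz⟩ := hf n hn
    exact Part.dom_iff_mem.2 ⟨z, he _ _ _ hz⟩
  exact fun p hp q hq => hM.prefixFree y p q (hdom p hp) (hdom q hq)

/-! ### Removing a numerical condition. -/

/-- A number given as the length of the condition costs at most that many bits. -/
theorem IsUniversalPrefixFreeMachine.K_le_condK_replicate
    {U : List Bool → List Bool →. List Bool} (hU : IsUniversalPrefixFreeMachine U) :
    ∃ d : ℕ, ∀ k x, K U x ≤ condK U x (List.replicate k true) + k + d := by
  -- The program `1^i 0 p` runs `U` on `p` with condition `1^i`; the header is self-delimiting.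
  let M : List Bool → List Bool →. List Bool := fun p _ =>
    (((if p.idxOf false < p.length then some (p.idxOf false) else none : Option ℕ)) :
      Part ℕ).bind fun i => U (p.drop (i + 1)) (List.replicate i true)
  have hmem : ∀ p y x, x ∈ M p y ↔ p.idxOf false < p.length ∧
      x ∈ U (p.drop (p.idxOf false + 1)) (List.replicate (p.idxOf false) true) := by
    intro p y x
    simp only [M]
    split_ifs with h <;> simp [h]
  have hrep : Primrec fun i : ℕ => List.replicate i true :=
    (Primrec.list_map Primrec.list_range (Primrec.const true).to₂).of_eq fun n => by simp
  have hidx : Primrec fun p : List Bool => p.idxOf false :=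
    Primrec.list_idxOf.comp (Primrec.const false) Primrec.id
  have hM : IsPrefixFreeMachine M := by
    constructor
    · refine Partrec.bind (Computable.ofOption (Primrec.to_comp ?_))
        (hU.isPrefixFreeMachine.partrec.comp (Primrec.to_comp ?_) (Primrec.to_comp ?_))
      · exact Primrec.ite (Primrec.nat_lt.comp (hidx.comp Primrec.fst)
          (Primrec.list_length.comp Primrec.fst))
          (Primrec.option_some.comp (hidx.comp Primrec.fst)) (Primrec.const none)
      · exact Primrec.list_drop.comp (Primrec.succ.comp Primrec.snd)
          (Primrec.fst.comp Primrec.fst)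
      · exact hrep.comp Primrec.snd
    · intro y p q hp hq hpq
      obtain ⟨h1, h2⟩ := (hmem _ y _).1 (Part.get_mem hp)
      obtain ⟨h3, h4⟩ := (hmem _ y _).1 (Part.get_mem hq)
      have hi : q.idxOf false = p.idxOf false := by
        obtain ⟨z, rfl⟩ := hpq
        exact List.idxOf_append_of_mem (List.idxOf_lt_length_iff.1 h1)
      have e1 := eq_prefix_of_idxOf p h1
      have e2 := eq_prefix_of_idxOf q h3
      rw [hi] at h4 e2
      rw [e1, e2, hU.isPrefixFreeMachine.prefixFree _ _ _ (Part.dom_iff_mem.2 ⟨_, h2⟩)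
        (Part.dom_iff_mem.2 ⟨_, h4⟩) (hpq.drop _)]
  obtain ⟨d, hd⟩ := hU.universal M hM
  refine ⟨d + 1, fun k x => ?_⟩
  obtain ⟨p, hp, hl⟩ := hU.exists_length_eq x (List.replicate k true)
  have hx : x ∈ M (List.replicate k true ++ false :: p) [] := by
    refine (hmem _ [] _).2 ?_
    rw [idxOf_replicate]
    refine ⟨by simp, ?_⟩
    have hdrop : (List.replicate k true ++ false :: p).drop (k + 1) = p := by
      rw [List.drop_append]; simp
    rwa [hdrop]
  obtain ⟨q, hq, hle⟩ := hd _ [] _ hx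
  have h1 : K U x ≤ q.length := condK_le hq
  simp only [List.length_append, List.length_replicate, List.length_cons] at hle
  omega

/-! ### Requests derived from programs for pairs. -/

/-- The first component of a coded pair. -/
def pairFst (z : List Bool) : List Bool :=
  (z.drop (z.idxOf false + 1)).take (z.idxOf false)

/-- The second component of a coded pair. -/
def pairSnd (z : List Bool) : List Bool :=
  (z.drop (z.idxOf false + 1)).drop (z.idxOf false)

theorem drop_pair (x y : List Bool) :
    (pair x y).drop ((pair x y).idxOf false + 1) = x ++ y ∧ (pair x y).idxOf false = x.length := by
  have h : (pair x y).idxOf false = x.length := idxOf_replicate _ _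
  refine ⟨?_, h⟩
  rw [h, pair, List.drop_append]
  simp

theorem pairFst_pair (x y : List Bool) : pairFst (pair x y) = x := by
  rw [pairFst, (drop_pair x y).1, (drop_pair x y).2, List.take_left]

theorem pairSnd_pair (x y : List Bool) : pairSnd (pair x y) = y := by
  rw [pairSnd, (drop_pair x y).1, (drop_pair x y).2, List.drop_left]

theorem primrec_pairFst : Primrec pairFst := by
  have hidx : Primrec fun p : List Bool => p.idxOf false :=
    Primrec.list_idxOf.comp (Primrec.const false) Primrec.id
  exact Primrec.list_take.comp hidx (Primrec.list_drop.comp (Primrec.succ.comp hidx) Primrec.id)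

theorem primrec_pairSnd : Primrec pairSnd := by
  have hidx : Primrec fun p : List Bool => p.idxOf false :=
    Primrec.list_idxOf.comp (Primrec.const false) Primrec.id
  exact Primrec.list_drop.comp hidx (Primrec.list_drop.comp (Primrec.succ.comp hidx) Primrec.id)

/-- The requests for programs computing `τ` from `a.2 = σ`: every program `p` for the pair `(σ, τ)`
that is enumerated by `e` asks for the length `|p| - |σ|`, up to the constant `a.1`. -/
def condRequest (e : ℕ → Option (List Bool × List Bool)) (a : ℕ × List Bool) (n : ℕ) :
    Option (ℕ × List Bool) :=
  (e n).bind fun b =>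
    if pairFst b.2 = a.2 then some (b.1.length + a.1 - a.2.length, pairSnd b.2) else none

/-- The requests for programs computing those `σ` for which the weight of `condRequest` reaches
`1`; the slack in `condRequest` is twice the length of `y`. -/
def overflowRequest (e : ℕ → Option (List Bool × List Bool)) (y : List Bool) (n : ℕ) :
    Option (ℕ × List Bool) :=
  (e n).bind fun b =>
    let s := kraftState fun i => (condRequest e (2 * y.length, pairFst b.2) i).map Prod.fst
    if (s n).1 < (s n).2 ∧ ¬ (s (n + 1)).1 < (s (n + 1)).2 then
      some ((pairFst b.2).length - 2 * y.length, pairFst b.2) else none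

theorem primrec_condRequest {e : ℕ → Option (List Bool × List Bool)} (he : Primrec e) :
    Primrec₂ (condRequest e) := by
  refine Primrec.option_bind (he.comp Primrec.snd) ?_
  have hz : Primrec fun b : ((ℕ × List Bool) × ℕ) × List Bool × List Bool => b.2.2 :=
    Primrec.snd.comp Primrec.snd
  have ha : Primrec fun b : ((ℕ × List Bool) × ℕ) × List Bool × List Bool => b.1.1 :=
    Primrec.fst.comp Primrec.fst
  refine Primrec.ite (Primrec.eq.comp (primrec_pairFst.comp hz) (Primrec.snd.comp ha))
    (Primrec.option_some.comp (Primrec.pair ?_ (primrec_pairSnd.comp hz))) (Primrec.const none)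
  exact Primrec.nat_sub.comp (Primrec.nat_add.comp
    (Primrec.list_length.comp (Primrec.fst.comp Primrec.snd)) (Primrec.fst.comp ha))
    (Primrec.list_length.comp (Primrec.snd.comp ha))

theorem primrec_overflowRequest {e : ℕ → Option (List Bool × List Bool)} (he : Primrec e) :
    Primrec₂ (overflowRequest e) := by
  refine Primrec.option_bind (he.comp Primrec.snd) ?_
  have hσ : Primrec fun b : (List Bool × ℕ) × List Bool × List Bool => pairFst b.2.2 :=
    primrec_pairFst.comp (Primrec.snd.comp Primrec.snd)
  have hk : Primrec fun b : (List Bool × ℕ) × List Bool × List Bool => 2 * b.1.1.length :=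
    Primrec.nat_mul.comp (Primrec.const 2)
      (Primrec.list_length.comp (Primrec.fst.comp Primrec.fst))
  have hn : Primrec fun b : (List Bool × ℕ) × List Bool × List Bool => b.1.2 :=
    Primrec.snd.comp Primrec.fst
  have hs := primrec_kraftState (ℓ := fun a i => (condRequest e a i).map Prod.fst)
    (Primrec.option_map (primrec_condRequest he) (Primrec.fst.comp Primrec.snd))
  have hs0 := hs.comp (Primrec.pair hk hσ) hn
  have hs1 := hs.comp (Primrec.pair hk hσ) (Primrec.succ.comp hn)
  exact Primrec.ite (PrimrecPred.and
      (Primrec.nat_lt.comp (Primrec.fst.comp hs0) (Primrec.snd.comp hs0))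
      (PrimrecPred.not (Primrec.nat_lt.comp (Primrec.fst.comp hs1) (Primrec.snd.comp hs1))))
    (Primrec.option_some.comp (Primrec.pair
      (Primrec.nat_sub.comp (Primrec.list_length.comp hσ) hk) hσ)) (Primrec.const none)

/-- The weight of the `i`-th program enumerated by `e` if it outputs a pair `(σ, τ)`. -/
noncomputable def pairWeight (e : ℕ → Option (List Bool × List Bool)) (σ : List Bool) (i : ℕ) : ℝ :=
  (e i).elim 0 fun b => if pairFst b.2 = σ then (1 / 2) ^ b.1.length else 0

/-- Equality holds without truncation; truncating the exponent at 0 only lowers the weight. Both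
kinds of requests with truncated lengths are controlled this way. -/
theorem half_pow_sub_le (m n : ℕ) : (1 / 2 : ℝ) ^ (m - n) ≤ 2 ^ n * (1 / 2) ^ m := by
  rcases le_total n m with h | h
  · obtain ⟨d, rfl⟩ := Nat.exists_eq_add_of_le h
    rw [Nat.add_sub_cancel_left, pow_add, ← mul_assoc, ← mul_pow]
    norm_num
  · obtain ⟨d, rfl⟩ := Nat.exists_eq_add_of_le h
    have h1 : (1 : ℝ) ≤ 2 ^ d := one_le_pow₀ (by norm_num)
    have h2 : (2 : ℝ) ^ m * (1 / 2) ^ m = 1 := by rw [← mul_pow]; norm_num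
    rw [Nat.sub_eq_zero_of_le h, pow_zero, pow_add]
    nlinarith

theorem kraftSum_condRequest_le (e : ℕ → Option (List Bool × List Bool)) (k : ℕ) (σ : List Bool)
    (N : ℕ) : 2 ^ k * (1 / 2 : ℝ) ^ σ.length *
        kraftSum (fun i => (condRequest e (k, σ) i).map Prod.fst) N ≤
      ∑ i ∈ Finset.range N, pairWeight e σ i := by
  rw [kraftSum, Finset.mul_sum]
  refine Finset.sum_le_sum fun i _ => ?_
  unfold condRequest pairWeight
  cases e i with
  | none => simp
  | some b =>
    simp only [Option.bind_some, Option.elim_some]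
    split_ifs with h
    · simp only [Option.map_some, Option.elim_some]
      have h1 := half_pow_sub_le (b.1.length + k) σ.length
      have h2 : ∀ m : ℕ, (2 : ℝ) ^ m * (1 / 2) ^ m = 1 := fun m => by rw [← mul_pow]; norm_num
      calc (2 : ℝ) ^ k * (1 / 2) ^ σ.length * (1 / 2) ^ (b.1.length + k - σ.length)
          ≤ 2 ^ k * (1 / 2) ^ σ.length * (2 ^ σ.length * (1 / 2) ^ (b.1.length + k)) := by gcongr
        _ = (2 ^ k * (1 / 2) ^ k) * (2 ^ σ.length * (1 / 2) ^ σ.length) *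
            (1 / 2) ^ b.1.length := by ring
        _ = (1 / 2) ^ b.1.length := by rw [h2, h2]; ring
    · simp

theorem overflowRequest_eq_some_iff {e : ℕ → Option (List Bool × List Bool)} {y σ : List Bool}
    {n l : ℕ} : overflowRequest e y n = some (l, σ) ↔
      (∃ b, e n = some b ∧ pairFst b.2 = σ) ∧ l = σ.length - 2 * y.length ∧
      kraftSum (fun i => (condRequest e (2 * y.length, σ) i).map Prod.fst) n < 1 ∧
      1 ≤ kraftSum (fun i => (condRequest e (2 * y.length, σ) i).map Prod.fst) (n + 1) := by
  unfold overflowRequest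
  cases e n with
  | none => simp
  | some b =>
    simp only [Option.bind_some, ← kraftSum_lt_one_iff, not_lt, Option.some.injEq, exists_eq_left']
    constructor
    · intro h
      split_ifs at h with hc
      simp only [Option.some.injEq, Prod.mk.injEq] at h
      obtain ⟨rfl, rfl⟩ := h
      exact ⟨rfl, rfl, hc⟩
    · rintro ⟨rfl, rfl, hc⟩
      rw [if_pos hc]

/-- Each program is charged to at most one `σ`, since `pairFst` is a total function of its output.
-/
theorem sum_pairWeight_le (e : ℕ → Option (List Bool × List Bool)) (T : Finset (List Bool))
    (N : ℕ) : ∑ σ ∈ T, ∑ i ∈ Finset.range N, pairWeight e σ i ≤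
      kraftSum (fun n => (e n).map fun a => a.1.length) N := by
  rw [Finset.sum_comm, kraftSum]
  refine Finset.sum_le_sum fun i _ => ?_
  unfold pairWeight
  cases e i with
  | none => simp
  | some b =>
    simp only [Option.elim_some, Option.map_some, Finset.sum_ite_eq]
    split_ifs
    · exact le_rfl
    · positivity

theorem kraftSum_overflowRequest_le (e : ℕ → Option (List Bool × List Bool)) (y : List Bool)
    (N : ℕ) : kraftSum (fun i => (overflowRequest e y i).map Prod.fst) N ≤
      kraftSum (fun n => (e n).map fun a => a.1.length) N := by
  classical
  let T := (Finset.range N).filter fun n => (overflowRequest e y n).isSome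
  let f : ℕ → List Bool := fun n => ((overflowRequest e y n).getD (0, [])).2
  have hf : ∀ n ∈ T, overflowRequest e y n = some ((f n).length - 2 * y.length, f n) := by
    intro n hn
    obtain ⟨⟨l, σ⟩, ha⟩ := Option.isSome_iff_exists.1 (Finset.mem_filter.1 hn).2
    simp only [f, ha, Option.getD_some]
    rw [(overflowRequest_eq_some_iff.1 ha).2.1]
  -- The monotone weight crosses 1 at most once, so each `σ` is requested at most once.
  have hlt : ∀ n ∈ T, ∀ m ∈ T, f n = f m → m ≤ n := by
    intro n hn m hm h
    by_contra! hnm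
    have h1 := (overflowRequest_eq_some_iff.1 (hf n hn)).2.2.2
    have h2 := (overflowRequest_eq_some_iff.1 (hf m hm)).2.2.1
    rw [← h] at h2
    exact absurd (h1.trans (kraftSum_mono _ (Nat.succ_le_of_lt hnm))) (not_le.2 h2)
  refine le_trans ?_ (sum_pairWeight_le e (T.image f) N)
  rw [Finset.sum_image fun n hn m hm h => le_antisymm (hlt m hm n hn h.symm) (hlt n hn m hm h)]
  have hT : kraftSum (fun i => (overflowRequest e y i).map Prod.fst) N =
      ∑ n ∈ T, (1 / 2 : ℝ) ^ ((f n).length - 2 * y.length) := by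
    rw [kraftSum, Finset.sum_filter]
    refine Finset.sum_congr rfl fun n hn => ?_
    split_ifs with h
    · rw [hf n (Finset.mem_filter.2 ⟨hn, h⟩)]
      simp
    · rw [Option.not_isSome_iff_eq_none.1 h]
      simp
  rw [hT]
  refine Finset.sum_le_sum fun n hn => ?_
  have h1 := (overflowRequest_eq_some_iff.1 (hf n hn)).2.2.2
  have h2 := kraftSum_mono (fun i => (condRequest e (2 * y.length, f n) i).map Prod.fst)
    (Nat.succ_le_of_lt (Finset.mem_range.1 (Finset.mem_filter.1 hn).1))
  -- Since the conditional weight has reached 1, the program weight of `f n` pays for its request.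
  refine (half_pow_sub_le _ _).trans
    (le_trans ?_ (kraftSum_condRequest_le e (2 * y.length) (f n) N))
  exact le_mul_of_one_le_right (by positivity) (h1.trans h2)

/-! ### Symmetry of information. -/

/-- Symmetry of information for strings of almost maximal complexity. -/
theorem IsUniversalPrefixFreeMachine.length_add_condK_le {U : List Bool → List Bool →. List Bool}
    (hU : IsUniversalPrefixFreeMachine U) (c : ℝ) :
    ∃ C : ℕ, ∀ σ τ : List Bool, (K U σ : ℝ) > (σ.length : ℝ) - c →
      σ.length + condK U τ σ ≤ pairK U σ τ + C := by
  obtain ⟨e, he, hsound, hcomplete, hinj⟩ := exists_enumeration (M := fun p => U p [])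
    (hU.isPrefixFreeMachine.partrec.comp Computable.id (Computable.const []))
  have hkraft := hU.isPrefixFreeMachine.kraftSum_le_one hsound hinj
  obtain ⟨d₀, hd₀⟩ := hU.K_le_condK_replicate
  obtain ⟨d₁, hd₁⟩ := hU.condK_le_of_request (primrec_overflowRequest he)
  -- There is no circularity: `k` enters the overflow requests only through the condition, so `d₀`
  -- and `d₁` do not depend on it. The later `d₂` may.
  obtain ⟨k, hk⟩ := exists_nat_ge (d₀ + d₁ + c)
  obtain ⟨d₂, hd₂⟩ := hU.condK_le_of_request (r := fun σ => condRequest e (2 * k, σ))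
    ((primrec_condRequest he).comp (Primrec.pair (Primrec.const (2 * k)) Primrec.fst) Primrec.snd)
  refine ⟨2 * k + d₂, fun σ τ hσ => ?_⟩
  let S := kraftSum fun i => (condRequest e (2 * k, σ) i).map Prod.fst
  have hS : ∀ n, S n < 1 := by
    intro n
    induction n with
    | zero => simp [S, kraftSum]
    | succ n ih =>
      by_contra! h
      -- Makes the subtraction in the overflow length exact. For shorter `σ`, reaching weight 1
      -- would force program weight at least 2.
      have hlen : 2 * k ≤ σ.length := by
        by_contra! hlt
        have h1 := kraftSum_condRequest_le e (2 * k) σ (n + 1)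
        have h2 := sum_pairWeight_le e {σ} (n + 1)
        rw [Finset.sum_singleton] at h2
        have h3 : (2 : ℝ) ≤ 2 ^ (2 * k) * (1 / 2) ^ σ.length := by
          obtain ⟨j, hj⟩ := Nat.exists_eq_add_of_lt hlt
          have h4 : (1 : ℝ) ≤ 2 ^ j := one_le_pow₀ (by norm_num)
          have h5 : (2 : ℝ) ^ σ.length * (1 / 2) ^ σ.length = 1 := by rw [← mul_pow]; norm_num
          rw [hj, pow_succ, pow_add]
          nlinarith
        have h4 : (1 : ℝ) ≤ kraftSum (fun i => (condRequest e (2 * k, σ) i).map Prod.fst) (n + 1) :=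
          h
        nlinarith [hkraft (n + 1)]
      -- The weight can increase only at an index listing a program charged to `σ`.
      have hsome : ∃ b, e n = some b ∧ pairFst b.2 = σ := by
        by_contra! hne
        have hnone : condRequest e (2 * k, σ) n = none := by
          rw [condRequest, Option.bind_eq_none_iff]
          exact fun b hb => if_neg (hne b hb)
        have : S (n + 1) = S n := by simp [S, kraftSum, Finset.sum_range_succ, hnone]
        linarith
      have hreq : overflowRequest e (List.replicate k true) n = some (σ.length - 2 * k, σ) := by
        rw [overflowRequest_eq_some_iff, List.length_replicate]
        exact ⟨hsome, rfl, ih, h⟩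
      have h1 := hd₁ _ _ _ _ hreq ((kraftSum_overflowRequest_le e _ _).trans (hkraft _))
      have h2 := hd₀ k σ
      have h3 : K U σ + k ≤ σ.length + d₀ + d₁ := by omega
      have h4 : (K U σ : ℝ) + k ≤ σ.length + d₀ + d₁ := by exact_mod_cast h3
      linarith
  obtain ⟨p, hp, hpl⟩ := hU.exists_length_eq (pair σ τ) []
  obtain ⟨n, hn⟩ := hcomplete p _ hp
  have hreq : condRequest e (2 * k, σ) n = some (p.length + 2 * k - σ.length, τ) := by
    simp [condRequest, hn, pairFst_pair, pairSnd_pair]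
  -- A request of length 0 has weight 1 and would already exceed the bound on `S`; so this
  -- subtraction is not truncated either.
  have hpos : p.length + 2 * k - σ.length ≠ 0 := by
    intro h0
    have h1 := hS (n + 1)
    have h2 : S 0 ≤ S n := kraftSum_mono _ (Nat.zero_le n)
    have hzero : S 0 = 0 := by simp [S, kraftSum]
    have h3 : S (n + 1) = S n + (1 / 2) ^ 0 := kraftSum_succ (by simp [hreq, h0])
    linarith
  have h := hd₂ σ τ n _ hreq (hS (n + 1)).le
  have hpair : pairK U σ τ = p.length := hpl.symm
  omega

end PrefixComplexity

theorem mainTheorem10 (U : List Bool → List Bool →. List Bool)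
    (hU : PrefixComplexity.IsUniversalPrefixFreeMachine U) (c : ℝ) :
    ∃ C : ℕ, ∀ σ τ : List Bool, (PrefixComplexity.K U σ : ℝ) > (σ.length : ℝ) - c →
      σ.length + PrefixComplexity.condK U τ σ ≤ PrefixComplexity.pairK U σ τ + C :=
  hU.length_add_condK_le c
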